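/- Let $F$ be a Dedekind $\sigma$-complete (real) Banach lattice, i.e. every nonempty countable subset of $F$ that is bounded above has a supremum. For a Banach lattice $E$ let $\mathcal L(E,F)$ be the set of continuous linear operators from $E$ to $F$, and let $\mathcal L^r(E,F)$ be the set of regular operators, i.e. linear operators from $E$ to $F$ that are the difference of two positive linear operators. An L-space is a Banach lattice $E$ with $\|x+y\|=\|x\|+\|y\|$ for all $x,y\ge 0$ in $E$. The following conditions are equivalent. (a) $F$ has a sequentially Levi norm: every norm-bounded increasing sequence of positive elements of $F$ has a supremum in $F$. (b) For every separable L-space $E$ the equality $\mathcal L(E,F)=\mathcal L^r(E,F)$ holds. (c) For $E=L_1[0,2\pi]$ the equality $\mathcal L(E,F)=\mathcal L^r(E,F)$ holds. -/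

import Mathlib

universe u v

open MeasureTheory

/-- Dedekind `σ`-completeness: every nonempty countable subset that is bounded above has a
supremum. -/
def DedekindSigmaComplete (F : Type*) [Preorder F] : Prop :=
  ∀ s : Set F, s.Nonempty → s.Countable → BddAbove s → ∃ x, IsLUB s x

/-- The norm is sequentially Levi: every norm-bounded increasing sequence of positive elements
has a supremum. -/
def SequentiallyLevi (F : Type*) [NormedAddCommGroup F] [Preorder F] : Prop :=
  ∀ x : ℕ → F, Monotone x → (∀ n, 0 ≤ x n) → (∃ C : ℝ, ∀ n, ‖x n‖ ≤ C) →
    ∃ s, IsLUB (Set.range x) s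

/-- The norm is additive on the positive cone. A Banach lattice with this property is an
L-space. -/
def AdditiveNorm (E : Type*) [NormedAddCommGroup E] [Preorder E] : Prop :=
  ∀ x y : E, 0 ≤ x → 0 ≤ y → ‖x + y‖ = ‖x‖ + ‖y‖

section Operators

variable (E F : Type*) [NormedAddCommGroup E] [NormedSpace ℝ E] [PartialOrder E]
  [NormedAddCommGroup F] [NormedSpace ℝ F] [PartialOrder F]

/-- The continuous linear operators from `E` to `F`. -/
def continuousOperators : Set (E →ₗ[ℝ] F) :=
  {T | Continuous T}

/-- The regular operators from `E` to `F`: the linear operators that are differences of two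
positive linear operators (continuity is not part of the definition). -/
def regularOperators : Set (E →ₗ[ℝ] F) :=
  {T | ∃ P Q : E →ₚ[ℝ] F, T = P.toLinearMap - Q.toLinearMap}

end Operators

/-- The Banach lattice `L₁[0, 2π]` of (classes of) Lebesgue integrable real functions, with the
almost everywhere order. -/
abbrev L1Interval : Type :=
  Lp ℝ 1 (volume.restrict (Set.Icc (0 : ℝ) (2 * Real.pi)))

/-! ### Inequalities in vector lattices -/

section VectorLattice

variable {F : Type*} [AddCommGroup F] [Lattice F] [IsOrderedAddMonoid F]

/-! From (a) to (b): for `T` continuous and `x ≥ 0`, the sums `∑ |T aᵢ|` over positive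
decompositions of `x` form a directed set, by Riesz decomposition. It is separable, and additivity
of the norm bounds it by `‖T‖ ‖x‖`. The Levi property gives its supremum `M x`; `M` extends to a
positive `P ≥ T`, so `T = P - (P - T)` is regular. Conversely, positive operators on a Banach
lattice are continuous. For (c), `L₁` is a separable L-space.

From (c) to (a): let `uₙ ≥ 0` have norm-bounded partial sums. By the Riemann–Lebesgue lemma, `T f =
∑ (∫ f sin((n+1)t)) uₙ` converges and is continuous. It sends `sin((n+1)t)` to `π uₙ`; as `|sin| ≤
1`, regularity of `T` makes `(uₙ)` order bounded. This is `BoundedSummands`.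

It remains to bound an increasing sequence `x`, not just its increments
(`BoundedSummands.sequentiallyLevi`). Bounded increments suffice when they are disjoint, since
disjoint sums are suprema; applied to band components, this bounds the norm of `z = sup (xₙ ⊓ e)`
independently of `e`. With `e = ∑ 2⁻ⁿ xₙ`, the truncations of `x` at `2ʲ e` are then norm bounded,
and their increments control the sequence itself. -/

theorem IsLUB.inf_le {s : Set F} {y a z : F} (hy : IsLUB s y) (h : ∀ p ∈ s, p ⊓ a ≤ z) :
    y ⊓ a ≤ z := by
  have h1 : y ≤ z + y ⊔ a - a := by
    refine hy.2 fun p hp => ?_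
    rw [le_sub_iff_add_le, ← inf_add_sup p a]
    exact add_le_add (h p hp) (sup_le_sup_right (hy.1 hp) _)
  rw [le_sub_iff_add_le, ← inf_add_sup y a] at h1
  exact le_of_add_le_add_right h1

/-- A sum of disjoint elements is their supremum, so bounding the two parts bounds the sum without a
factor 2. Iterated, this bounds a sequence by a bound of its disjoint increments. -/
theorem le_of_inf_sub_le_zero {q z w : F} (hq : q ≤ w) (hz : z - q ≤ w) (h : q ⊓ (z - q) ≤ 0) :
    z ≤ w := by
  have h1 : q + (z - q) = q ⊓ (z - q) + q ⊔ (z - q) := (inf_add_sup q (z - q)).symm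
  rw [add_sub_cancel] at h1
  rw [h1]
  calc _ ≤ 0 + w := add_le_add h (sup_le hq hz)
    _ = w := zero_add w

variable [Module ℝ F] [IsOrderedModule ℝ F]

/-- The supremum of `z ⊓ m • v`, the component of `z` in the band generated by `v`, is disjoint
from its complement. -/
theorem inf_sub_le_zero_of_isLUB {z v q : F}
    (hq : IsLUB (Set.range fun m : ℕ => z ⊓ (m : ℝ) • v) q) : q ⊓ (z - q) ≤ 0 := by
  have hle : ∀ m : ℕ, z ⊓ (m : ℝ) • v ≤ q := fun m => hq.1 ⟨m, rfl⟩
  have hqz : q ≤ z := hq.2 (by rintro _ ⟨m, rfl⟩; exact inf_le_left)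
  have hzq : 0 ≤ z - q := sub_nonneg.2 hqz
  -- iterating, `z ⊓ m v + k ((z - q) ⊓ v) ≤ q`
  have ht : (z - q) ⊓ v ≤ 0 := by
    have : q ≤ q - (z - q) ⊓ v := by
      refine hq.2 ?_
      rintro _ ⟨m, rfl⟩
      refine le_sub_iff_add_le.2 (le_trans (le_inf ?_ ?_) (hle (m + 1)))
      · calc _ ≤ q + (z - q) := add_le_add (hle m) inf_le_left
          _ = z := add_sub_cancel _ _
      · push_cast
        rw [add_smul, one_smul]
        exact add_le_add inf_le_right inf_le_right
    simpa using this
  have hdis : ∀ m : ℕ, ((m : ℝ) • v) ⊓ (z - q) ≤ 0 := by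
    intro m
    rcases Nat.eq_zero_or_pos m with rfl | hm
    · simp
    have h1 : (1 : ℝ) ≤ m := by exact_mod_cast hm
    have h0 : (0 : ℝ) < m := by linarith
    calc ((m : ℝ) • v) ⊓ (z - q) ≤ (m : ℝ) • (v ⊓ (z - q)) := by
          rw [← inv_smul_le_iff_of_pos h0]
          refine le_inf ?_ ?_
          · rw [inv_smul_le_iff_of_pos h0]; exact inf_le_left
          · rw [inv_smul_le_iff_of_pos h0]
            refine inf_le_right.trans ?_
            simpa using smul_le_smul_of_nonneg_right h1 hzq
      _ ≤ 0 := smul_nonpos_of_nonneg_of_nonpos h0.le (by rwa [inf_comm])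
  refine hq.inf_le ?_
  rintro _ ⟨m, rfl⟩
  exact (inf_le_inf_right _ inf_le_right).trans (hdis m)

/-- The left side lives where `x > z/2`, and there `z ≤ 2x`. Formally, it is disjoint from `2 d⁻ ≤
z`, so it is at most `z - 2 d⁻ ≤ 2x`. -/
theorem inf_smul_posPart_le {x z : F} {c : ℝ} (hx : 0 ≤ x) (hz : 0 ≤ z) (hc : 0 ≤ c) :
    z ⊓ c • (x - (2⁻¹ : ℝ) • z)⁺ ≤ (2 : ℝ) • x := by
  set d := x - (2⁻¹ : ℝ) • z with hd
  have hdis : d⁻ ⊓ c • d⁺ ≤ 0 := by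
    have h1 : d⁺ ⊓ d⁻ = 0 := posPart_inf_negPart_eq_zero d
    have hc1 : (0 : ℝ) < c + 1 := by linarith
    calc d⁻ ⊓ c • d⁺ ≤ (c + 1) • (d⁺ ⊓ d⁻) := by
          rw [← inv_smul_le_iff_of_pos hc1]
          refine le_inf ?_ ?_
          · rw [inv_smul_le_iff_of_pos hc1]
            refine inf_le_right.trans ?_
            exact smul_le_smul_of_nonneg_right (by linarith) (posPart_nonneg d)
          · rw [inv_smul_le_iff_of_pos hc1]
            refine inf_le_left.trans ?_
            simpa using smul_le_smul_of_nonneg_right (by linarith : (1 : ℝ) ≤ c + 1)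
              (negPart_nonneg d)
      _ = 0 := by rw [h1, smul_zero]
  have h2 : (2⁻¹ : ℝ) • z + d⁺ = x + d⁻ := by
    have := posPart_sub_negPart d
    rw [sub_eq_iff_eq_add] at this
    rw [this, hd]; abel
  have hneg : d⁻ ≤ (2⁻¹ : ℝ) • z := by
    rw [negPart_def]
    refine sup_le ?_ (smul_nonneg (by norm_num) hz)
    rw [hd, neg_sub]; exact sub_le_self _ hx
  have h3 : z ⊓ c • d⁺ ≤ z - (2 : ℝ) • d⁻ := by
    rw [le_sub_iff_add_le]
    have h4 : (z ⊓ c • d⁺) ⊓ (2 : ℝ) • d⁻ ≤ 0 := by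
      calc _ ≤ (2 : ℝ) • (d⁻ ⊓ c • d⁺) := by
            rw [← inv_smul_le_iff_of_pos (by norm_num : (0 : ℝ) < 2)]
            have h5 : 0 ≤ (z ⊓ c • d⁺) ⊓ (2 : ℝ) • d⁻ :=
              le_inf (le_inf hz (smul_nonneg hc (posPart_nonneg d)))
                (smul_nonneg (by norm_num) (negPart_nonneg d))
            refine le_inf ?_ ?_
            · rw [inv_smul_le_iff_of_pos (by norm_num : (0 : ℝ) < 2)]
              exact inf_le_right
            · refine le_trans (b := (z ⊓ c • d⁺) ⊓ (2 : ℝ) • d⁻) ?_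
                (inf_le_left.trans inf_le_right)
              simpa using smul_le_smul_of_nonneg_right (by norm_num : (2⁻¹ : ℝ) ≤ 1) h5
        _ ≤ 0 := smul_nonpos_of_nonneg_of_nonpos (by norm_num) hdis
    rw [← inf_add_sup]
    calc _ ≤ 0 + z := add_le_add h4 (sup_le inf_le_left (by
          have := smul_le_smul_of_nonneg_left hneg (by norm_num : (0 : ℝ) ≤ 2)
          rwa [smul_smul, mul_inv_cancel₀ two_ne_zero, one_smul] at this))
      _ = z := zero_add z
  refine h3.trans ?_
  have h6 : -d ≤ d⁻ := neg_le_negPart d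
  have := smul_le_smul_of_nonneg_left h6 (by norm_num : (0 : ℝ) ≤ 2)
  rw [sub_le_iff_le_add]
  have e : (2 : ℝ) • (-d) = z - (2 : ℝ) • x := by rw [hd]; module
  rw [e] at this
  exact sub_le_iff_le_add'.1 this

/-- Pointwise: where `y ≤ a` the first term is `y`; where `a < y ≤ 2a` the difference is `a/2`, and
four times it is `2a`. -/
theorem le_sup_smul_inf_sub_inf {y a : F} (ha : 0 ≤ a) (h : y ≤ (2 : ℝ) • a) :
    y ≤ (y ⊓ a) ⊔ (4 : ℝ) • (y ⊓ a - y ⊓ (2⁻¹ : ℝ) • a) := by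
  let _ : DistribLattice F := AddCommGroup.toDistribLattice F
  have h1 : ((4 : ℝ) • y - (2 : ℝ) • a) ⊓ ((2 : ℝ) • a) ≤
      (4 : ℝ) • (y ⊓ a - y ⊓ (2⁻¹ : ℝ) • a) := by
    have h2 : (4 : ℝ) • (y ⊓ a - (2⁻¹ : ℝ) • a) ≤ (4 : ℝ) • (y ⊓ a - y ⊓ (2⁻¹ : ℝ) • a) :=
      smul_le_smul_of_nonneg_left (sub_le_sub_left inf_le_right _) (by norm_num)
    refine le_trans ?_ h2
    rw [← inv_smul_le_iff_of_pos (by norm_num : (0 : ℝ) < 4), le_sub_iff_add_le]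
    refine le_inf ?_ ?_
    · rw [← le_sub_iff_add_le, inv_smul_le_iff_of_pos (by norm_num : (0 : ℝ) < 4)]
      refine inf_le_left.trans (le_of_eq ?_)
      module
    · rw [← le_sub_iff_add_le, inv_smul_le_iff_of_pos (by norm_num : (0 : ℝ) < 4)]
      refine inf_le_right.trans (le_of_eq ?_)
      module
  refine le_trans ?_ (sup_le_sup_left h1 _)
  rw [sup_inf_left]
  refine le_inf ?_ (h.trans le_sup_right)
  set s := (y ⊓ a) ⊔ ((4 : ℝ) • y - (2 : ℝ) • a) with hs
  have h5 : s = (y ⊔ ((4 : ℝ) • y - (2 : ℝ) • a)) ⊓ (a ⊔ ((4 : ℝ) • y - (2 : ℝ) • a)) :=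
    sup_inf_right _ _ _
  rw [h5]
  refine le_inf le_sup_left ?_
  -- `y` lies below the convex combination of `a` and `4y - 2a` with weights 3/4 and 1/4, hence
  -- below their supremum.
  set r := a ⊔ ((4 : ℝ) • y - (2 : ℝ) • a)
  have h6 : (3 : ℝ) • a + ((4 : ℝ) • y - (2 : ℝ) • a) ≤ (3 : ℝ) • r + r :=
    add_le_add (smul_le_smul_of_nonneg_left le_sup_left (by norm_num)) le_sup_right
  have h7 : (4 : ℝ) • y ≤ (4 : ℝ) • r := by
    calc (4 : ℝ) • y ≤ (4 : ℝ) • y + a := le_add_of_nonneg_right ha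
      _ = (3 : ℝ) • a + ((4 : ℝ) • y - (2 : ℝ) • a) := by module
      _ ≤ (3 : ℝ) • r + r := h6
      _ = (4 : ℝ) • r := by module
  exact le_of_smul_le_smul_left h7 (by norm_num)

end VectorLattice

/-! ### From order-bounded summands to the Levi property -/

/-- Every sequence of positive elements with norm-bounded partial sums is order bounded. -/
def BoundedSummands (F : Type*) [NormedAddCommGroup F] [Preorder F] : Prop :=
  ∀ u : ℕ → F, (∀ n, 0 ≤ u n) → (∃ C : ℝ, ∀ N, ‖∑ n ∈ Finset.range N, u n‖ ≤ C) →
    BddAbove (Set.range u)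

theorem DedekindSigmaComplete.exists_isLUB_range {F : Type*} [Preorder F] (hF : DedekindSigmaComplete F) {x : ℕ → F} {b : F}
    (h : ∀ n, x n ≤ b) : ∃ z, IsLUB (Set.range x) z :=
  hF _ (Set.range_nonempty x) (Set.countable_range x) ⟨b, by rintro _ ⟨n, rfl⟩; exact h n⟩

section Increments

variable {F : Type*} [NormedAddCommGroup F]

/-- The sequence of increments of `q`, starting from `0`. -/
def increments (q : ℕ → F) : ℕ → F
  | 0 => q 0
  | n + 1 => q (n + 1) - q n

theorem sum_increments (q : ℕ → F) (N : ℕ) : ∑ n ∈ Finset.range (N + 1), increments q n = q N := by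
  induction N with
  | zero => simp [increments]
  | succ N ih => rw [Finset.sum_range_succ, ih]; simp [increments]

theorem norm_sum_increments_le {q : ℕ → F} {C : ℝ} (hC : ∀ n, ‖q n‖ ≤ C) (N : ℕ) :
    ‖∑ n ∈ Finset.range N, increments q n‖ ≤ C := by
  cases N with
  | zero => simpa using (norm_nonneg _).trans (hC 0)
  | succ N => rw [sum_increments]; exact hC N

theorem increments_nonneg [Lattice F] [IsOrderedAddMonoid F] {q : ℕ → F} (hq : Monotone q) (h0 : 0 ≤ q 0) (n : ℕ) :
    0 ≤ increments q n := by
  cases n with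
  | zero => exact h0
  | succ n => exact sub_nonneg.2 (hq n.le_succ)

end Increments

section BanachLattice

variable {F : Type*} [NormedAddCommGroup F] [Lattice F]
    [IsOrderedAddMonoid F] [HasSolidNorm F]

theorem norm_le_norm_of_nonneg_of_le {x y : F} (hx : 0 ≤ x) (h : x ≤ y) : ‖x‖ ≤ ‖y‖ :=
  norm_le_norm_of_abs_le_abs (by rwa [abs_of_nonneg hx, abs_of_nonneg (hx.trans h)])

variable [NormedSpace ℝ F] [IsOrderedModule ℝ F]

/-- A uniform bound for the upper bounds in `BoundedSummands`. -/
theorem BoundedSummands.exists_norm_bound (h : BoundedSummands F) :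
    ∃ K : ℝ, ∀ u : ℕ → F, (∀ n, 0 ≤ u n) → (∀ N, ‖∑ n ∈ Finset.range N, u n‖ ≤ 1) →
      ∃ w, (∀ n, u n ≤ w) ∧ ‖w‖ ≤ K := by
  by_contra! hcon
  choose u hu0 hu1 hu using fun j : ℕ => hcon ((4 : ℝ) ^ j)
  -- The weights `2⁻ʲ` keep the partial sums of the merged families below 2, while an upper bound
  -- `w` would make `2ʲ w` a bound of family `j`, so `4ʲ < 2ʲ ‖w‖` for all `j`.
  set v : ℕ × ℕ → F := fun p => ((1 / 2 : ℝ) ^ p.1) • u p.1 p.2 with hv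
  have hv0 : ∀ p, 0 ≤ v p := fun p => smul_nonneg (by positivity) (hu0 _ _)
  obtain ⟨w, hw⟩ := h (fun n => v n.unpair) (fun n => hv0 _) ⟨2, fun N => by
    have h1 : ∑ n ∈ Finset.range N, v n.unpair ≤
        ∑ p ∈ Finset.range N ×ˢ Finset.range N, v p := by
      rw [← Finset.sum_image (f := v) (g := Nat.unpair) (s := Finset.range N)
        (Nat.pairEquiv.symm.injective.injOn)]
      refine Finset.sum_le_sum_of_subset_of_nonneg ?_ fun p _ _ => hv0 p
      intro p hp
      obtain ⟨n, hn, rfl⟩ := Finset.mem_image.1 hp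
      rw [Finset.mem_range] at hn
      exact Finset.mem_product.2 ⟨Finset.mem_range.2 ((Nat.unpair_left_le n).trans_lt hn),
        Finset.mem_range.2 ((Nat.unpair_right_le n).trans_lt hn)⟩
    refine (norm_le_norm_of_nonneg_of_le (Finset.sum_nonneg fun n _ => hv0 _) h1).trans ?_
    rw [Finset.sum_product]
    refine (norm_sum_le _ _).trans (le_trans (Finset.sum_le_sum fun j _ => ?_)
      (sum_geometric_two_le N))
    simp only [hv]
    rw [← Finset.smul_sum, norm_smul, Real.norm_of_nonneg (by positivity)]
    exact mul_le_of_le_one_right (by positivity) (hu1 j N)⟩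
  have h2 : ∀ j : ℕ, (2 : ℝ) ^ j ≤ ‖w‖ := by
    intro j
    have h3 : ∀ n, u j n ≤ (2 : ℝ) ^ j • w := by
      intro n
      have h4 : v (j, n) ≤ w := by
        have := hw ⟨Nat.pair j n, rfl⟩
        simpa using this
      have h5 := smul_le_smul_of_nonneg_left h4 (by positivity : (0 : ℝ) ≤ 2 ^ j)
      simp only [hv] at h5
      rwa [smul_smul, ← mul_pow, mul_one_div_cancel two_ne_zero, one_pow, one_smul] at h5
    have h6 := (hu j _ h3).le
    rw [norm_smul, Real.norm_of_nonneg (by positivity),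
      (by norm_num : (4 : ℝ) = 2 * 2), mul_pow] at h6
    exact le_of_mul_le_mul_left h6 (by positivity)
  obtain ⟨j, hj⟩ := pow_unbounded_of_one_lt ‖w‖ (one_lt_two : (1 : ℝ) < 2)
  exact (h2 j).not_gt hj

/-- Truncations of a norm-bounded increasing sequence have uniformly bounded suprema. -/
theorem BoundedSummands.exists_norm_isLUB_inf_le (h : BoundedSummands F)
    (hF : DedekindSigmaComplete F) {x : ℕ → F} (hx : Monotone x) (hx0 : ∀ n, 0 ≤ x n)
    {C : ℝ} (hC : ∀ n, ‖x n‖ ≤ C) :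
    ∃ K : ℝ, ∀ e z : F, 0 ≤ e → IsLUB (Set.range fun n => x n ⊓ e) z → ‖z‖ ≤ K := by
  obtain ⟨K, hK⟩ := h.exists_norm_bound
  -- `D` bounds `‖2 xₙ‖`; the `+ 1` makes it invertible.
  set D : ℝ := 2 * (|C| + 1) with hD
  have hD0 : 0 < D := by positivity
  refine ⟨D * K, fun e z he hz => ?_⟩
  have hz0 : 0 ≤ z := (le_inf (hx0 0) he).trans (hz.1 ⟨0, rfl⟩)
  -- `q n` is the component of `z` in the band where `xₙ > z/2`. It is dominated by `2 xₙ`, and each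
  -- new increment is disjoint from the previous component.
  have hex : ∀ n, ∃ q, IsLUB (Set.range fun m : ℕ => z ⊓ (m : ℝ) • (x n - (2⁻¹ : ℝ) • z)⁺) q :=
    fun n => hF.exists_isLUB_range (b := z) fun m => inf_le_left
  choose q hq using hex
  have hqz : ∀ n, q n ≤ z := fun n => (hq n).2 (by rintro _ ⟨m, rfl⟩; exact inf_le_left)
  have hq0 : ∀ n, 0 ≤ q n := fun n => by
    refine le_trans ?_ ((hq n).1 ⟨0, rfl⟩)
    simpa using hz0
  have hqm : Monotone q := by
    intro n n' hn
    refine (hq n).2 ?_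
    rintro _ ⟨m, rfl⟩
    refine le_trans (inf_le_inf_left _ ?_) ((hq n').1 ⟨m, rfl⟩)
    exact smul_le_smul_of_nonneg_left (posPart_mono (sub_le_sub_right (hx hn) _)) (Nat.cast_nonneg m)
  have hqx : ∀ n, q n ≤ (2 : ℝ) • x n := fun n => (hq n).2 (by
    rintro _ ⟨m, rfl⟩; exact inf_smul_posPart_le (hx0 n) hz0 (Nat.cast_nonneg m))
  have hqn : ∀ n, ‖q n‖ ≤ D := fun n => by
    refine (norm_le_norm_of_nonneg_of_le (hq0 n) (hqx n)).trans ?_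
    rw [norm_smul, Real.norm_of_nonneg (by norm_num), hD]
    have := (hC n).trans (le_abs_self C)
    linarith
  obtain ⟨w, hw, hwK⟩ := hK (fun n => D⁻¹ • increments q n)
    (fun n => smul_nonneg (by positivity) (increments_nonneg hqm (hq0 0) n)) (fun N => by
      rw [← Finset.smul_sum, norm_smul, Real.norm_of_nonneg (by positivity),
        inv_mul_le_iff₀ hD0, mul_one]
      exact norm_sum_increments_le hqn N)
  have hw' : ∀ n, increments q n ≤ D • w := fun n => (inv_smul_le_iff_of_pos hD0).1 (hw n)
  have hqw : ∀ n, q n ≤ D • w := by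
    intro n
    induction n with
    | zero => exact hw' 0
    | succ n ih =>
      refine le_of_inf_sub_le_zero ih (hw' (n + 1)) ?_
      exact (inf_le_inf_left _ (sub_le_sub_right (hqz _) _)).trans (inf_sub_le_zero_of_isLUB (hq n))
  have hfin : ∀ n, x n ⊓ e ≤ (2⁻¹ : ℝ) • (D • w + z) := by
    intro n
    have h0 : x n ⊓ e ≤ z := hz.1 ⟨n, rfl⟩
    have h1 : (2 : ℝ) • (x n ⊓ e) - z ≤ D • w := by
      -- The multiple `m = 2` suffices, since `2 (xₙ - z/2)⁺ ≥ 2 xₙ - z`.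
      refine le_trans ?_ (((hq n).1 ⟨2, rfl⟩).trans (hqw n))
      refine le_inf ?_ ?_
      · rw [sub_le_iff_le_add]
        refine (smul_le_smul_of_nonneg_left h0 zero_le_two).trans (le_of_eq ?_)
        rw [two_smul]
      · refine le_trans ?_ (smul_le_smul_of_nonneg_left (le_posPart _) (Nat.cast_nonneg 2))
        refine (sub_le_sub_right (smul_le_smul_of_nonneg_left inf_le_left zero_le_two) z).trans
          (le_of_eq ?_)
        push_cast
        module
    rw [sub_le_iff_le_add] at h1
    exact (le_inv_smul_iff_of_pos zero_lt_two).2 h1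
  have hzw : z ≤ D • w := by
    have h1 : z ≤ (2⁻¹ : ℝ) • (D • w + z) := hz.2 (by rintro _ ⟨n, rfl⟩; exact hfin n)
    rwa [le_inv_smul_iff_of_pos zero_lt_two, two_smul, add_le_add_iff_right] at h1
  refine (norm_le_norm_of_nonneg_of_le hz0 hzw).trans ?_
  rw [norm_smul, Real.norm_of_nonneg hD0.le]
  exact mul_le_mul_of_nonneg_left hwK hD0.le

/-- The dyadic truncations of a sequence have comparable increments, so that an upper bound of
the increments yields one of the sequence. -/
theorem BoundedSummands.sequentiallyLevi [CompleteSpace F] (h : BoundedSummands F)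
    (hF : DedekindSigmaComplete F) : SequentiallyLevi F := by
  rintro x hx hx0 ⟨C, hC⟩
  obtain ⟨K, hK⟩ := h.exists_norm_isLUB_inf_le hF hx hx0 hC
  have hsum : Summable fun n => ((1 / 2 : ℝ) ^ n) • x n := by
    refine Summable.of_norm_bounded (g := fun n => (1 / 2 : ℝ) ^ n * C)
      (summable_geometric_two.mul_right C) fun n => ?_
    rw [norm_smul, Real.norm_of_nonneg (by positivity)]
    exact mul_le_mul_of_nonneg_left (hC n) (by positivity)
  have hterm0 : ∀ n, 0 ≤ ((1 / 2 : ℝ) ^ n) • x n := fun n => smul_nonneg (by positivity) (hx0 n)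
  obtain ⟨e, he⟩ : ∃ e, e = ∑' n, ((1 / 2 : ℝ) ^ n) • x n := ⟨_, rfl⟩
  have he0 : 0 ≤ e := he ▸ tsum_nonneg hterm0
  have hxe : ∀ n, x n ≤ (2 : ℝ) ^ n • e := by
    intro n
    have h1 : ((1 / 2 : ℝ) ^ n) • x n ≤ e := he ▸ hsum.le_tsum n fun m _ => hterm0 m
    have h2 := smul_le_smul_of_nonneg_left h1 (by positivity : (0 : ℝ) ≤ 2 ^ n)
    rwa [smul_smul, ← mul_pow, mul_one_div_cancel two_ne_zero, one_pow, one_smul] at h2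
  have hpe : ∀ n, 0 ≤ (2 : ℝ) ^ n • e := fun n => smul_nonneg (by positivity) he0
  choose z hz using fun j : ℕ =>
    hF.exists_isLUB_range (x := fun n => x n ⊓ (2 : ℝ) ^ j • e) (b := (2 : ℝ) ^ j • e)
      fun n => inf_le_right
  have hze : ∀ j, z j ≤ (2 : ℝ) ^ j • e := fun j =>
    (hz j).2 (by rintro _ ⟨n, rfl⟩; exact inf_le_right)
  have hz0 : ∀ j, 0 ≤ z j := fun j => (le_inf (hx0 0) (hpe j)).trans ((hz j).1 ⟨0, rfl⟩)
  have hzm : Monotone z := by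
    intro j j' hj
    refine (hz j).2 ?_
    rintro _ ⟨n, rfl⟩
    refine le_trans (inf_le_inf_left _ ?_) ((hz j').1 ⟨n, rfl⟩)
    exact smul_le_smul_of_nonneg_right (pow_le_pow_right₀ one_le_two hj) he0
  have hxz : ∀ n, x n ≤ z n := fun n => (le_inf le_rfl (hxe n)).trans ((hz n).1 ⟨n, rfl⟩)
  obtain ⟨w, hw⟩ := h (increments z) (increments_nonneg hzm (hz0 0))
    ⟨K, norm_sum_increments_le fun j => hK _ _ (hpe j) (hz j)⟩
  have hw' : ∀ n, increments z n ≤ w := fun n => hw ⟨n, rfl⟩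
  have hw0 : 0 ≤ w := (hz0 0).trans (hw' 0)
  -- Induction with `y = z (n + 2)` and `a = 2ⁿ⁺¹ e`: `y ⊓ a ≤ z (n + 1)` and `y ⊓ a/2 ≥ z n`, so
  -- the difference is at most one increment.
  have hle : ∀ n, z (n + 1) ≤ (4 : ℝ) • w := by
    intro n
    induction n with
    | zero =>
      have h1 : z 1 - z 0 ≤ w := hw' 1
      have h2 : z 0 ≤ w := hw' 0
      calc z 1 = (z 1 - z 0) + z 0 := by abel
        _ ≤ w + w := add_le_add h1 h2
        _ = (2 : ℝ) • w := (two_smul ℝ w).symm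
        _ ≤ (4 : ℝ) • w := smul_le_smul_of_nonneg_right (by norm_num) hw0
    | succ n ih =>
      have ha : (2⁻¹ : ℝ) • (2 : ℝ) ^ (n + 1) • e = (2 : ℝ) ^ n • e := by
        rw [smul_smul, pow_succ]; congr 1; ring
      have h1 : z (n + 2) ⊓ (2 : ℝ) ^ (n + 1) • e ≤ z (n + 1) := by
        refine (hz (n + 2)).inf_le ?_
        rintro _ ⟨m, rfl⟩
        exact (inf_le_inf_right _ inf_le_left).trans ((hz (n + 1)).1 ⟨m, rfl⟩)
      have h2 : z n ≤ z (n + 2) ⊓ (2⁻¹ : ℝ) • (2 : ℝ) ^ (n + 1) • e :=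
        le_inf (hzm (by lia)) (ha ▸ hze n)
      refine (le_sup_smul_inf_sub_inf (hpe (n + 1)) ((hze (n + 2)).trans (le_of_eq ?_))).trans
        (sup_le (h1.trans ih) (smul_le_smul_of_nonneg_left ?_ (by norm_num)))
      · rw [smul_smul, pow_succ']
      · exact (sub_le_sub h1 h2).trans (hw' (n + 1))
  exact hF.exists_isLUB_range fun n => (hxz n).trans ((hzm n.le_succ).trans (hle n))

end BanachLattice

/-! ### Operators defined by series -/

section SeriesOperator

variable {E F : Type*} [NormedAddCommGroup E] [NormedSpace ℝ E]
  [NormedAddCommGroup F] [NormedSpace ℝ F] [Lattice F] [IsOrderedAddMonoid F]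
  [IsOrderedModule ℝ F] [HasSolidNorm F]

/-- The sum is dominated in modulus by `δ` times a full partial sum, and the norm is solid. -/
theorem norm_sum_smul_le {u : ℕ → F} (hu : ∀ n, 0 ≤ u n) {C : ℝ}
    (hC : ∀ N, ‖∑ n ∈ Finset.range N, u n‖ ≤ C) {c : ℕ → ℝ} {δ : ℝ} (hδ : 0 ≤ δ) (t : Finset ℕ)
    (hc : ∀ n ∈ t, |c n| ≤ δ) : ‖∑ n ∈ t, c n • u n‖ ≤ δ * C := by
  obtain ⟨N, hN⟩ := t.exists_nat_subset_range
  have h0 : 0 ≤ ∑ n ∈ Finset.range N, u n := Finset.sum_nonneg fun n _ => hu n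
  have h1 : |∑ n ∈ t, c n • u n| ≤ δ • ∑ n ∈ Finset.range N, u n := by
    rw [Finset.smul_sum]
    refine le_trans ?_ (Finset.sum_le_sum_of_subset_of_nonneg hN
      fun n _ _ => smul_nonneg hδ (hu n))
    refine abs_le'.2 ⟨Finset.sum_le_sum fun n hn => ?_, ?_⟩
    · exact smul_le_smul_of_nonneg_right (abs_le.1 (hc n hn)).2 (hu n)
    · rw [← Finset.sum_neg_distrib]
      refine Finset.sum_le_sum fun n hn => ?_
      rw [← neg_smul]
      exact smul_le_smul_of_nonneg_right (neg_le.1 (abs_le.1 (hc n hn)).1) (hu n)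
  calc ‖∑ n ∈ t, c n • u n‖ ≤ ‖δ • ∑ n ∈ Finset.range N, u n‖ :=
        norm_le_norm_of_abs_le_abs (h1.trans (le_abs_self _))
    _ = δ * ‖∑ n ∈ Finset.range N, u n‖ := by rw [norm_smul, Real.norm_of_nonneg hδ]
    _ ≤ δ * C := mul_le_mul_of_nonneg_left (hC N) hδ

theorem summable_smul_of_tendsto_zero [CompleteSpace F] {u : ℕ → F} (hu : ∀ n, 0 ≤ u n) {C : ℝ}
    (hC : ∀ N, ‖∑ n ∈ Finset.range N, u n‖ ≤ C) {c : ℕ → ℝ}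
    (hc : Filter.Tendsto c Filter.atTop (nhds 0)) : Summable fun n => c n • u n := by
  rw [summable_iff_vanishing_norm]
  intro ε hε
  have hC0 : 0 ≤ C := (norm_nonneg _).trans (hC 0)
  obtain ⟨N, hN⟩ := Metric.tendsto_atTop.1 hc (ε / (C + 1)) (by positivity)
  refine ⟨Finset.range N, fun t ht => ?_⟩
  refine (norm_sum_smul_le hu hC (δ := ε / (C + 1)) (by positivity) t fun n hn => ?_).trans_lt ?_
  · have hn' : N ≤ n := by
      by_contra! h
      exact Finset.disjoint_left.1 ht hn (Finset.mem_range.2 h)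
    simpa using (hN n hn').le
  · rw [div_mul_eq_mul_div, div_lt_iff₀ (by positivity)]
    nlinarith

/-- A norm-bounded series of positive elements defines a continuous operator through a
weak-star null sequence of functionals. -/
theorem exists_continuous_hasSum_smul [CompleteSpace F] {u : ℕ → F} (hu : ∀ n, 0 ≤ u n) {C : ℝ}
    (hC : ∀ N, ‖∑ n ∈ Finset.range N, u n‖ ≤ C) (a : ℕ → E →ₗ[ℝ] ℝ)
    (ha : ∀ n f, |a n f| ≤ ‖f‖)
    (ha0 : ∀ f, Filter.Tendsto (fun n => a n f) Filter.atTop (nhds 0)) :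
    ∃ T : E →ₗ[ℝ] F, Continuous T ∧ ∀ f, HasSum (fun n => a n f • u n) (T f) := by
  have hs : ∀ f, Summable fun n => a n f • u n := fun f =>
    summable_smul_of_tendsto_zero hu hC (ha0 f)
  let T : E →ₗ[ℝ] F :=
    { toFun := fun f => ∑' n, a n f • u n
      map_add' := fun f g => by
        rw [← (hs f).tsum_add (hs g)]
        simp only [map_add, add_smul]
      map_smul' := fun c f => by
        rw [RingHom.id_apply, ← (hs f).tsum_const_smul]
        simp only [map_smul, smul_eq_mul, mul_smul] }
  have hT : ∀ f, HasSum (fun n => a n f • u n) (T f) := fun f => (hs f).hasSum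
  refine ⟨T, AddMonoidHomClass.continuous_of_bound T C fun f => ?_, hT⟩
  rw [mul_comm]
  exact le_of_tendsto (hT f).norm (Filter.Eventually.of_forall fun t =>
    norm_sum_smul_le hu hC (norm_nonneg f) t fun n _ => ha n f)

end SeriesOperator

/-! ### Riemann–Lebesgue lemma and orthogonality of sines -/

section Sine

open Real

theorem tendsto_integral_mul_sin {f : ℝ → ℝ} {s : Set ℝ} (hs : MeasurableSet s) (hf : IntegrableOn f s) :
    Filter.Tendsto (fun n : ℕ => ∫ t in s, f t * sin (((n : ℝ) + 1) * t))
      Filter.atTop (nhds 0) := by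
  have h := Real.tendsto_integral_exp_smul_cocompact (fun t => ((s.indicator f t : ℝ) : ℂ))
  have h2 : Filter.Tendsto (fun n : ℕ => ((n : ℝ) + 1) / (2 * π)) Filter.atTop
      (Filter.cocompact ℝ) := by
    refine Filter.Tendsto.mono_right ?_ atTop_le_cocompact
    exact (Filter.tendsto_atTop_add_const_right _ _ tendsto_natCast_atTop_atTop).atTop_div_const
      (by positivity)
  -- The sine integral is minus the imaginary part of the Fourier transform at frequency `(n + 1) /
  -- (2π)`.
  have h3 := (Complex.continuous_im.tendsto 0).comp (h.comp h2)
  have h4 := h3.neg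
  simp only [Complex.zero_im, neg_zero] at h4
  refine h4.congr fun n => ?_
  simp only [Function.comp]
  have hint : Integrable (fun v : ℝ => fourierChar (-(v * (((n : ℝ) + 1) / (2 * π)))) •
      ((s.indicator f v : ℝ) : ℂ)) := by
    simp_rw [Circle.smul_def, smul_eq_mul]
    refine ((integrable_indicator_iff hs).2 hf).ofReal.bdd_mul (c := 1) ?_
      (Filter.Eventually.of_forall fun v => (Circle.norm_coe _).le)
    exact (by fun_prop : Continuous fun v : ℝ =>
      (fourierChar (-(v * (((n : ℝ) + 1) / (2 * π)))) : ℂ)).aestronglyMeasurable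
  rw [← Complex.imCLM_apply, ← Complex.imCLM.integral_comp_comm hint, ← integral_neg,
    ← integral_indicator hs]
  refine integral_congr_ae (Filter.Eventually.of_forall fun v => ?_)
  have e : 2 * π * -(v * (((n : ℝ) + 1) / (2 * π))) = -(((n : ℝ) + 1) * v) := by
    field_simp
  by_cases hv : v ∈ s
  · simp only [Set.indicator_of_mem hv, Circle.smul_def, smul_eq_mul, Real.fourierChar_apply, e,
      Complex.imCLM_apply, Complex.im_mul_ofReal, Complex.exp_ofReal_mul_I_im, sin_neg]
    ring
  · simp [Set.indicator_of_notMem hv]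

theorem integral_sin_mul_sin (m n : ℕ) :
    ∫ t in Set.Icc 0 (2 * π), sin (((m : ℝ) + 1) * t) * sin (((n : ℝ) + 1) * t) =
      if m = n then π else 0 := by
  have hcos : ∀ k : ℤ, k ≠ 0 → ∫ t in (0 : ℝ)..(2 * π), cos (k * t) = 0 := by
    intro k hk
    have hk' : (k : ℝ) ≠ 0 := by exact_mod_cast hk
    rw [intervalIntegral.integral_comp_mul_left (fun t => cos t) hk', integral_cos]
    have : sin ((k : ℝ) * (2 * π)) = 0 := by
      have := sin_int_mul_pi (2 * k)
      push_cast at this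
      rw [← this]; ring_nf
    simp [this]
  rw [integral_Icc_eq_integral_Ioc, ← intervalIntegral.integral_of_le (by positivity)]
  have h1 : ∀ t : ℝ, sin (((m : ℝ) + 1) * t) * sin (((n : ℝ) + 1) * t) =
      2⁻¹ * (cos (((m : ℤ) - n : ℤ) * t) - cos (((m : ℤ) + n + 2 : ℤ) * t)) := by
    intro t
    have e1 : (((m : ℤ) - n : ℤ) : ℝ) * t = ((m : ℝ) + 1) * t - ((n : ℝ) + 1) * t := by
      push_cast; ring
    have e2 : (((m : ℤ) + n + 2 : ℤ) : ℝ) * t = ((m : ℝ) + 1) * t + ((n : ℝ) + 1) * t := by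
      push_cast; ring
    rw [e1, e2, cos_sub, cos_add]; ring
  simp_rw [h1]
  rw [intervalIntegral.integral_const_mul, intervalIntegral.integral_sub
    (Continuous.intervalIntegrable (by fun_prop) _ _)
    (Continuous.intervalIntegrable (by fun_prop) _ _), hcos ((m : ℤ) + n + 2) (by lia)]
  split_ifs with h
  · subst h
    simp
  · rw [hcos ((m : ℤ) - n) (by lia)]
    simp

end Sine

/-! ### Testing regularity on the sine functions -/

section L1

open Real

variable {F : Type*} [NormedAddCommGroup F] [NormedSpace ℝ F] [Lattice F] [IsOrderedAddMonoid F]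
  [IsOrderedModule ℝ F] [HasSolidNorm F]

theorem BoundedSummands.of_continuousOperators_subset [CompleteSpace F]
    (h : continuousOperators L1Interval F ⊆ regularOperators L1Interval F) :
    BoundedSummands F := by
  rintro u hu ⟨C, hC⟩
  set μ : Measure ℝ := volume.restrict (Set.Icc (0 : ℝ) (2 * π)) with hμ
  have hmeas : ∀ n : ℕ, AEStronglyMeasurable (fun t : ℝ => sin (((n : ℝ) + 1) * t)) μ := fun n =>
    (by fun_prop : Continuous fun t : ℝ => sin (((n : ℝ) + 1) * t)).aestronglyMeasurable
  have hint : ∀ (f : Lp ℝ 1 μ) (n : ℕ), Integrable (fun t => f t * sin (((n : ℝ) + 1) * t)) μ :=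
    fun f n => (L1.integrable_coeFn f).mul_bdd (c := 1) (hmeas n)
      (Filter.Eventually.of_forall fun t => by simpa using abs_sin_le_one _)
  let a : ℕ → L1Interval →ₗ[ℝ] ℝ := fun n =>
    { toFun := fun f => ∫ t, f t * sin (((n : ℝ) + 1) * t) ∂μ
      map_add' := fun f g => by
        rw [← integral_add (hint f n) (hint g n)]
        refine integral_congr_ae ?_
        filter_upwards [Lp.coeFn_add f g] with t ht
        rw [ht, Pi.add_apply, add_mul]
      map_smul' := fun c f => by
        rw [RingHom.id_apply, smul_eq_mul, ← integral_const_mul]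
        refine integral_congr_ae ?_
        filter_upwards [Lp.coeFn_smul c f] with t ht
        rw [ht, Pi.smul_apply, smul_eq_mul, mul_assoc] }
  obtain ⟨T, hT, hTs⟩ := exists_continuous_hasSum_smul hu hC a (fun n f => by
      rw [L1.norm_eq_integral_norm]
      change ‖∫ t, f t * sin (((n : ℝ) + 1) * t) ∂μ‖ ≤ _
      refine norm_integral_le_of_norm_le (L1.integrable_coeFn f).norm
        (Filter.Eventually.of_forall fun t => ?_)
      rw [norm_mul]
      exact mul_le_of_le_one_right (norm_nonneg _) (abs_sin_le_one _))
    (fun f => tendsto_integral_mul_sin measurableSet_Icc (L1.integrable_coeFn f))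
  obtain ⟨P, Q, hPQ⟩ := h hT
  have hsin : ∀ n : ℕ, MemLp (fun t : ℝ => sin (((n : ℝ) + 1) * t)) 1 μ := fun n =>
    MemLp.of_bound (hmeas n) 1 (Filter.Eventually.of_forall fun t => abs_sin_le_one _)
  let s : ℕ → L1Interval := fun n => (hsin n).toLp
  let e : L1Interval := (memLp_const (1 : ℝ) : MemLp (fun _ : ℝ => (1 : ℝ)) 1 μ).toLp
  have he : ∀ᵐ t ∂μ, (e : ℝ → ℝ) t = 1 := MemLp.coeFn_toLp _
  have hse : ∀ n, s n ≤ e := fun n => by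
    rw [← Lp.coeFn_le]
    filter_upwards [he, MemLp.coeFn_toLp (hsin n)] with t h1 h2
    rw [h1, h2]
    exact sin_le_one _
  have hes : ∀ n, -e ≤ s n := fun n => by
    rw [← Lp.coeFn_le]
    filter_upwards [he, Lp.coeFn_neg e, MemLp.coeFn_toLp (hsin n)] with t h1 h2 h3
    rw [h2, Pi.neg_apply, h1, h3]
    exact neg_one_le_sin _
  have has : ∀ m n, a m (s n) = if m = n then π else 0 := fun m n => by
    rw [← integral_sin_mul_sin]
    refine integral_congr_ae ?_
    filter_upwards [MemLp.coeFn_toLp (hsin n)] with t ht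
    rw [ht, mul_comm]
  have hTn : ∀ n, T (s n) = π • u n := fun n => by
    refine (hTs (s n)).unique ?_
    convert! hasSum_ite_eq n (π • u n) using 2 with m
    rw [has]
    split_ifs with h
    · rw [h]
    · rw [zero_smul]
  -- Since `-e ≤ s n ≤ e`, one has `π uₙ = P (s n) - Q (s n) ≤ P e + Q e`.
  refine ⟨(π⁻¹ : ℝ) • (P e + Q e), ?_⟩
  rintro _ ⟨n, rfl⟩
  rw [le_inv_smul_iff_of_pos pi_pos, ← hTn, hPQ]
  have h1 : P (s n) ≤ P e := P.monotone' (hse n)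
  have h2 : Q (-e) ≤ Q (s n) := Q.monotone' (hes n)
  rw [map_neg, neg_le] at h2
  change P (s n) - Q (s n) ≤ _
  rw [sub_eq_add_neg]
  exact add_le_add h1 h2

end L1

/-! ### Continuity and extension of positive operators -/

section PositiveOperators

variable {E F : Type*} [NormedAddCommGroup E] [NormedSpace ℝ E] [Lattice E]
  [IsOrderedAddMonoid E] [IsOrderedModule ℝ E] [HasSolidNorm E]
  [NormedAddCommGroup F] [NormedSpace ℝ F] [Lattice F] [IsOrderedAddMonoid F]
  [IsOrderedModule ℝ F] [HasSolidNorm F]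

omit [IsOrderedAddMonoid E] [IsOrderedModule ℝ E] [HasSolidNorm E] [IsOrderedAddMonoid F]
  [IsOrderedModule ℝ F] [HasSolidNorm F] in
theorem PositiveLinearMap.abs_apply_le (P : E →ₚ[ℝ] F) (x : E) : |P x| ≤ P |x| := by
  refine abs_le'.2 ⟨P.monotone' (le_abs_self x), ?_⟩
  rw [← map_neg]
  exact P.monotone' (neg_le_abs x)

omit [IsOrderedModule ℝ F] in
/-- Positive operators on a Banach lattice are continuous. -/
theorem PositiveLinearMap.continuous_of_completeSpace [CompleteSpace E] (P : E →ₚ[ℝ] F) :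
    Continuous P.toLinearMap := by
  suffices h : ∃ C : ℝ, ∀ x, ‖P.toLinearMap x‖ ≤ C * ‖x‖ by
    obtain ⟨C, hC⟩ := h
    exact AddMonoidHomClass.continuous_of_bound P.toLinearMap C hC
  by_contra! hcon
  choose x hx using fun n : ℕ => hcon ((4 : ℝ) ^ n)
  have hx0 : ∀ n, 0 < ‖x n‖ := fun n => norm_pos_iff.2 fun h0 => by
    have := hx n
    rw [h0] at this
    simp at this
  -- The sum of the `y n` converges and dominates each `y n`, yet `‖P (y n)‖ ≥ 2ⁿ`.
  set y : ℕ → E := fun n => ((1 / 2 : ℝ) ^ n) • ‖x n‖⁻¹ • |x n| with hy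
  have hy0 : ∀ n, 0 ≤ y n := fun n =>
    smul_nonneg (by positivity) (smul_nonneg (by positivity) (abs_nonneg _))
  have hyn : ∀ n, ‖y n‖ ≤ (1 / 2 : ℝ) ^ n := fun n => by
    rw [hy, norm_smul, norm_smul, norm_abs_eq_norm, norm_inv, norm_norm,
      inv_mul_cancel₀ (hx0 n).ne', mul_one, Real.norm_of_nonneg (by positivity)]
  have hs : Summable y := Summable.of_norm_bounded summable_geometric_two hyn
  have h2 : ∀ n : ℕ, (2 : ℝ) ^ n ≤ ‖P (∑' n, y n)‖ := by
    intro n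
    have h3 : P (y n) ≤ P (∑' n, y n) := P.monotone' (hs.le_tsum n fun m _ => hy0 m)
    refine le_trans ?_ (norm_le_norm_of_nonneg_of_le (P.map_nonneg (hy0 n)) h3)
    have h4 : ‖P (x n)‖ ≤ ‖P |x n|‖ :=
      norm_le_norm_of_abs_le_abs ((P.abs_apply_le _).trans (le_abs_self _))
    have h5 : (4 : ℝ) ^ n * ‖x n‖ ≤ ‖P |x n|‖ := (hx n).le.trans h4
    rw [hy, map_smul, map_smul, norm_smul, norm_smul, norm_inv, norm_norm,
      Real.norm_of_nonneg (by positivity)]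
    calc (2 : ℝ) ^ n = (1 / 2 : ℝ) ^ n * (‖x n‖⁻¹ * (4 ^ n * ‖x n‖)) := by
          rw [mul_comm ((4 : ℝ) ^ n), inv_mul_cancel_left₀ (hx0 n).ne', ← mul_pow]
          norm_num
      _ ≤ _ := by gcongr
  obtain ⟨n, hn⟩ := pow_unbounded_of_one_lt ‖P (∑' n, y n)‖ (one_lt_two : (1 : ℝ) < 2)
  exact (h2 n).not_gt hn

omit [IsOrderedModule ℝ F] in
theorem regularOperators_subset_continuousOperators [CompleteSpace E] :
    regularOperators E F ⊆ continuousOperators E F := by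
  rintro _ ⟨P, Q, rfl⟩
  exact P.continuous_of_completeSpace.sub Q.continuous_of_completeSpace

omit [HasSolidNorm E] [IsOrderedModule ℝ F] [HasSolidNorm F] in
/-- A positive map on the positive cone that is additive and homogeneous extends to a positive
operator. -/
theorem exists_positiveLinearMap_extension (M : E → F) (h0 : ∀ x, 0 ≤ x → 0 ≤ M x)
    (hadd : ∀ x y, 0 ≤ x → 0 ≤ y → M (x + y) = M x + M y)
    (hsmul : ∀ (c : ℝ) x, 0 ≤ c → 0 ≤ x → M (c • x) = c • M x) :
    ∃ P : E →ₚ[ℝ] F, ∀ x, 0 ≤ x → P x = M x := by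
  set p : E → F := fun x => M x⁺ - M x⁻ with hp
  -- The value does not depend on how an element is written as a difference of positive ones;
  -- linearity follows from this.
  have hsub : ∀ a b : E, 0 ≤ a → 0 ≤ b → p (a - b) = M a - M b := by
    intro a b ha hb
    have h1 : (a - b)⁺ + b = a + (a - b)⁻ := by
      rw [← sub_eq_sub_iff_add_eq_add, posPart_sub_negPart]
    have h2 := congrArg M h1
    rw [hadd _ _ (posPart_nonneg _) hb, hadd _ _ ha (negPart_nonneg _)] at h2
    exact sub_eq_sub_iff_add_eq_add.2 h2
  have hpos : ∀ x, 0 ≤ x → p x = M x := fun x hx => by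
    have hM0 : M 0 = 0 := by simpa using hsmul 0 0 le_rfl le_rfl
    simpa [hM0] using hsub x 0 hx le_rfl
  have hpadd : ∀ x y, p (x + y) = p x + p y := fun x y => by
    have h1 : x + y = (x⁺ + y⁺) - (x⁻ + y⁻) := by
      conv_lhs => rw [← posPart_sub_negPart x, ← posPart_sub_negPart y]
      abel
    rw [h1, hsub _ _ (add_nonneg (posPart_nonneg _) (posPart_nonneg _))
      (add_nonneg (negPart_nonneg _) (negPart_nonneg _)),
      hadd _ _ (posPart_nonneg _) (posPart_nonneg _),
      hadd _ _ (negPart_nonneg _) (negPart_nonneg _)]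
    simp only [hp]
    abel
  have hpneg : ∀ x, p (-x) = -p x := fun x => by
    have h1 : -x = x⁻ - x⁺ := by rw [← neg_sub, posPart_sub_negPart]
    rw [h1, hsub _ _ (negPart_nonneg _) (posPart_nonneg _), neg_sub]
  have hpsmul0 : ∀ (c : ℝ) x, 0 ≤ c → p (c • x) = c • p x := fun c x hc => by
    have h1 : c • x = c • x⁺ - c • x⁻ := by rw [← smul_sub, posPart_sub_negPart]
    rw [h1, hsub _ _ (smul_nonneg hc (posPart_nonneg _)) (smul_nonneg hc (negPart_nonneg _)),
      hsmul _ _ hc (posPart_nonneg _), hsmul _ _ hc (negPart_nonneg _), ← smul_sub]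
  have hpsmul : ∀ (c : ℝ) x, p (c • x) = c • p x := fun c x => by
    rcases le_total 0 c with hc | hc
    · exact hpsmul0 c x hc
    · have := hpsmul0 (-c) x (neg_nonneg.2 hc)
      rwa [neg_smul, neg_smul, hpneg, neg_inj] at this
  let L : E →ₗ[ℝ] F := { toFun := p, map_add' := hpadd, map_smul' := hpsmul }
  refine ⟨PositiveLinearMap.mk₀ L fun x hx => ?_, hpos⟩
  change 0 ≤ p x
  rw [hpos x hx]
  exact h0 x hx

end PositiveOperators

theorem abs_smul_eq_smul_abs {F : Type*} [AddCommGroup F] [Module ℝ F] [Lattice F]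
    [IsOrderedModule ℝ F] {c : ℝ} (hc : 0 ≤ c) (y : F) : |c • y| = c • |y| := by
  have h1 : ∀ {d : ℝ} (x : F), 0 ≤ d → |d • x| ≤ d • |x| := fun x hd => by
    refine abs_le'.2 ⟨smul_le_smul_of_nonneg_left (le_abs_self x) hd, ?_⟩
    rw [← smul_neg]
    exact smul_le_smul_of_nonneg_left (neg_le_abs x) hd
  rcases hc.eq_or_lt with rfl | hc'
  · simp [abs]
  refine le_antisymm (h1 y hc) ((le_inv_smul_iff_of_pos hc').1 ?_)
  simpa [inv_smul_smul₀ hc'.ne'] using h1 (c • y) (inv_nonneg.2 hc)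

/-! ### The modulus of an operator through decompositions -/

section Modulus

variable {E F : Type*} [AddCommGroup E] [Module ℝ E] [Lattice E]
  [IsOrderedAddMonoid E]
  [AddCommGroup F] [Module ℝ F] [Lattice F] [IsOrderedAddMonoid F]

/-- The sum `∑ |T a|` over a list. -/
def absSum (T : E →ₗ[ℝ] F) (l : List E) : F := (l.map fun a => |T a|).sum

/-- The sums `∑ |T a|` over the decompositions of `x` into positive summands. -/
def modulusSums (T : E →ₗ[ℝ] F) (x : E) : Set F :=
  {y | ∃ l : List E, (∀ a ∈ l, 0 ≤ a) ∧ l.sum = x ∧ absSum T l = y}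

variable (T : E →ₗ[ℝ] F)

omit [Lattice E] [IsOrderedAddMonoid E] in
theorem absSum_nonneg (l : List E) : 0 ≤ absSum T l :=
  List.sum_nonneg fun _ hx => by
    obtain ⟨a, -, rfl⟩ := List.mem_map.1 hx
    exact abs_nonneg _

omit [Lattice E] [IsOrderedAddMonoid E] [IsOrderedAddMonoid F] in
@[simp] theorem absSum_cons (a : E) (l : List E) : absSum T (a :: l) = |T a| + absSum T l := rfl

omit [Lattice E] [IsOrderedAddMonoid E] [IsOrderedAddMonoid F] in
@[simp] theorem absSum_nil : absSum T [] = 0 := rfl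

omit [Lattice E] [IsOrderedAddMonoid E] [IsOrderedAddMonoid F] in
theorem absSum_append (l l' : List E) : absSum T (l ++ l') = absSum T l + absSum T l' := by
  simp [absSum]

omit [Lattice E] [IsOrderedAddMonoid E] in
theorem abs_apply_sum_le_absSum (l : List E) : |T l.sum| ≤ absSum T l := by
  induction l with
  | nil => simp
  | cons a l ih =>
    rw [List.sum_cons, map_add, absSum_cons]
    exact (abs_add_le _ _).trans (by gcongr)

/-- Riesz decomposition for lists. -/
theorem exists_absSum_le_add (l : List E) (hl : ∀ a ∈ l, 0 ≤ a) (x y : E) (hx : 0 ≤ x) (hy : 0 ≤ y)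
    (h : l.sum = x + y) :
    ∃ l₁ l₂ : List E, (∀ a ∈ l₁, 0 ≤ a) ∧ (∀ a ∈ l₂, 0 ≤ a) ∧ l₁.sum = x ∧ l₂.sum = y ∧
      absSum T l ≤ absSum T l₁ + absSum T l₂ := by
  induction l generalizing x y with
  | nil =>
    have h' : x + y = 0 := h.symm
    obtain ⟨rfl, rfl⟩ := (add_eq_zero_iff_of_nonneg hx hy).1 h'
    exact ⟨[], [], by simp⟩
  | cons a l ih =>
    rw [List.forall_mem_cons] at hl
    rw [List.sum_cons] at h
    have hl0 : 0 ≤ l.sum := List.sum_nonneg hl.2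
    have h1 : a - a ⊓ x ≤ y := by
      rw [sub_le_comm]
      refine le_inf (sub_le_self _ hy) ?_
      rw [sub_le_iff_le_add, ← h]
      exact le_add_of_nonneg_right hl0
    obtain ⟨l₁, l₂, h₁, h₂, e₁, e₂, hle⟩ := ih hl.2 (x - a ⊓ x) (y - (a - a ⊓ x))
      (sub_nonneg.2 inf_le_right) (sub_nonneg.2 h1)
      (by rw [eq_sub_of_add_eq' h]; abel)
    refine ⟨a ⊓ x :: l₁, (a - a ⊓ x) :: l₂, List.forall_mem_cons.2 ⟨le_inf hl.1 hx, h₁⟩,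
      List.forall_mem_cons.2 ⟨sub_nonneg.2 inf_le_left, h₂⟩, ?_, ?_, ?_⟩
    · rw [List.sum_cons, e₁]; abel
    · rw [List.sum_cons, e₂]; abel
    · simp only [absSum_cons]
      have h3 : |T a| ≤ |T (a ⊓ x)| + |T (a - a ⊓ x)| := by
        refine le_trans (le_of_eq ?_) (abs_add_le _ _)
        rw [← map_add, add_sub_cancel]
      calc _ ≤ (|T (a ⊓ x)| + |T (a - a ⊓ x)|) + (absSum T l₁ + absSum T l₂) := add_le_add h3 hle
        _ = _ := by abel

/-- Two decompositions have a common refinement: the first list is split along the head `b` of the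
second and the remainder, and the remainder is treated recursively. Refining only increases the
sums, by the triangle inequality. -/
theorem directedOn_modulusSums (x : E) : DirectedOn (· ≤ ·) (modulusSums T x) := by
  rintro _ ⟨l, hl, hlx, rfl⟩ _ ⟨l', hl', hlx', rfl⟩
  suffices h : ∃ m : List E, (∀ a ∈ m, 0 ≤ a) ∧ m.sum = x ∧ absSum T l ≤ absSum T m ∧
      absSum T l' ≤ absSum T m by
    obtain ⟨m, hm, hmx, h1, h2⟩ := h
    exact ⟨_, ⟨m, hm, hmx, rfl⟩, h1, h2⟩
  induction l' generalizing l x with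
  | nil =>
    exact ⟨l, hl, hlx, le_rfl, absSum_nonneg T l⟩
  | cons b l' ih =>
    rw [List.forall_mem_cons] at hl'
    rw [List.sum_cons] at hlx'
    obtain ⟨l₁, l₂, h₁, h₂, e₁, e₂, hle⟩ := exists_absSum_le_add T l hl b l'.sum hl'.1
      (List.sum_nonneg hl'.2) (hlx.trans hlx'.symm)
    obtain ⟨m, hm, hmx, g1, g2⟩ := ih l'.sum l₂ h₂ e₂ hl'.2 rfl
    refine ⟨l₁ ++ m, fun a ha => (List.mem_append.1 ha).elim (h₁ a) (hm a), ?_, ?_, ?_⟩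
    · rw [List.sum_append, e₁, hmx, hlx']
    · rw [absSum_append]
      exact hle.trans (by gcongr)
    · rw [absSum_append, absSum_cons]
      have := abs_apply_sum_le_absSum T l₁
      rw [e₁] at this
      exact add_le_add this g2

/-- Splitting a decomposition of `x + y` gives one inequality, concatenating decompositions of `x`
and `y` the other. -/
theorem isLUB_modulusSums_add {x y : E} (hx : 0 ≤ x) (hy : 0 ≤ y) {a b : F}
    (ha : IsLUB (modulusSums T x) a) (hb : IsLUB (modulusSums T y) b) :
    IsLUB (modulusSums T (x + y)) (a + b) := by
  refine ⟨?_, fun c hc => ?_⟩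
  · rintro _ ⟨l, hl, hlx, rfl⟩
    obtain ⟨l₁, l₂, h₁, h₂, e₁, e₂, hle⟩ := exists_absSum_le_add T l hl x y hx hy hlx
    exact hle.trans (add_le_add (ha.1 ⟨l₁, h₁, e₁, rfl⟩) (hb.1 ⟨l₂, h₂, e₂, rfl⟩))
  · rw [← le_sub_iff_add_le]
    refine ha.2 ?_
    rintro _ ⟨l₁, h₁, e₁, rfl⟩
    rw [le_sub_comm]
    refine hb.2 ?_
    rintro _ ⟨l₂, h₂, e₂, rfl⟩
    rw [le_sub_iff_add_le']
    refine hc ⟨l₁ ++ l₂, fun a ha => (List.mem_append.1 ha).elim (h₁ a) (h₂ a), ?_,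
      absSum_append T _ _⟩
    rw [List.sum_append, e₁, e₂]

variable [IsOrderedModule ℝ E] [IsOrderedModule ℝ F]

omit [IsOrderedAddMonoid E] [IsOrderedAddMonoid F] in
theorem smul_mem_modulusSums {x : E} {y : F} {c : ℝ} (hc : 0 ≤ c) (hy : y ∈ modulusSums T x) :
    c • y ∈ modulusSums T (c • x) := by
  obtain ⟨l, hl, rfl, rfl⟩ := hy
  refine ⟨l.map (c • ·), fun a ha => ?_, ?_, ?_⟩
  · obtain ⟨b, hb, rfl⟩ := List.mem_map.1 ha
    exact smul_nonneg hc (hl b hb)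
  · rw [List.smul_sum]
  · rw [absSum, absSum, List.smul_sum, List.map_map, List.map_map]
    congr 1
    refine List.map_congr_left fun a _ => ?_
    simp only [Function.comp, map_smul]
    exact abs_smul_eq_smul_abs hc _

omit [IsOrderedAddMonoid E] [IsOrderedAddMonoid F] in
theorem isLUB_modulusSums_smul {x : E} {a : F} {c : ℝ} (hc : 0 < c)
    (ha : IsLUB (modulusSums T x) a) : IsLUB (modulusSums T (c • x)) (c • a) := by
  refine ⟨fun y hy => ?_, fun b hb => ?_⟩
  · rw [← inv_smul_le_iff_of_pos hc]
    have := smul_mem_modulusSums T (inv_nonneg.2 hc.le) hy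
    rw [inv_smul_smul₀ hc.ne'] at this
    exact ha.1 this
  · rw [← le_inv_smul_iff_of_pos hc]
    refine ha.2 fun y hy => ?_
    rw [le_inv_smul_iff_of_pos hc]
    exact hb (smul_mem_modulusSums T hc.le hy)

end Modulus

/-! ### Regularity from the Levi property -/

section Levi

variable {E F : Type*} [NormedAddCommGroup E] [NormedSpace ℝ E] [Lattice E]
  [IsOrderedAddMonoid E] [IsOrderedModule ℝ E] [HasSolidNorm E]
  [NormedAddCommGroup F] [NormedSpace ℝ F] [Lattice F] [IsOrderedAddMonoid F]
  [IsOrderedModule ℝ F] [HasSolidNorm F]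

omit [NormedSpace ℝ F] [IsOrderedModule ℝ F] in
/-- With a sequentially Levi norm, norm-bounded separable directed sets of positive elements have
suprema. -/
theorem SequentiallyLevi.exists_isLUB_of_directedOn (h : SequentiallyLevi F) {S : Set F}
    (hne : S.Nonempty) (hdir : DirectedOn (· ≤ ·) S) (hS0 : ∀ y ∈ S, 0 ≤ y)
    (hsep : TopologicalSpace.IsSeparable S) {C : ℝ} (hC : ∀ y ∈ S, ‖y‖ ≤ C) :
    ∃ s, IsLUB S s := by
  obtain ⟨t, htS, htc, hSt⟩ := hsep.exists_countable_dense_subset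
  have htne : t.Nonempty := closure_nonempty_iff.1 (hne.mono hSt)
  obtain ⟨d, rfl⟩ := htc.exists_eq_range htne
  choose! r hrS hr1 hr2 using hdir
  -- Directedness yields an increasing sequence in `S` dominating a dense sequence. Its supremum
  -- bounds all of `S` because the set of elements below it is closed.
  let x : ℕ → F := fun n => Nat.rec (d 0) (fun n y => r y (d (n + 1))) n
  have hd : ∀ n, d n ∈ S := fun n => htS ⟨n, rfl⟩
  have hxS : ∀ n, x n ∈ S := by
    intro n
    induction n with
    | zero => exact hd 0
    | succ n ih => exact hrS _ ih _ (hd _)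
  have hdx : ∀ n, d n ≤ x n := by
    intro n
    cases n with
    | zero => exact le_rfl
    | succ n => exact hr2 _ (hxS n) _ (hd _)
  obtain ⟨s, hs⟩ := h x (monotone_nat_of_le_succ fun n => hr1 _ (hxS n) _ (hd _))
    (fun n => hS0 _ (hxS n)) ⟨C, fun n => hC _ (hxS n)⟩
  refine ⟨s, fun y hy => ?_, fun b hb => hs.2 (by rintro _ ⟨n, rfl⟩; exact hb (hxS n))⟩
  refine closure_minimal (t := Set.Iic s) ?_ isClosed_Iic (hSt hy)
  rintro _ ⟨n, rfl⟩
  exact (hdx n).trans (hs.1 ⟨n, rfl⟩)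

omit [NormedSpace ℝ E] [IsOrderedModule ℝ E] [HasSolidNorm E] in
theorem AdditiveNorm.norm_list_sum (hE : AdditiveNorm E) (l : List E) (hl : ∀ a ∈ l, 0 ≤ a) :
    ‖l.sum‖ = (l.map fun a => ‖a‖).sum := by
  induction l with
  | nil => simp
  | cons a l ih =>
    rw [List.forall_mem_cons] at hl
    rw [List.sum_cons, hE _ _ hl.1 (List.sum_nonneg hl.2), ih hl.2]
    rfl

omit [HasSolidNorm E] in
/-- Continuous operators on a separable L-space with values in a space with sequentially Levi
norm have a modulus. -/
theorem SequentiallyLevi.continuousOperators_subset [TopologicalSpace.SeparableSpace E]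
    (h : SequentiallyLevi F) (hE : AdditiveNorm E) :
    continuousOperators E F ⊆ regularOperators E F := by
  intro T hT
  let T' : E →L[ℝ] F := ⟨T, hT⟩
  have hex : ∀ x : E, 0 ≤ x → ∃ s, IsLUB (modulusSums T x) s := by
    intro x hx
    refine h.exists_isLUB_of_directedOn (C := ‖T'‖ * ‖x‖) ⟨_, [x], by simpa using hx, by simp, rfl⟩
      (directedOn_modulusSums T x) ?_ ?_ ?_
    · rintro _ ⟨l, -, -, rfl⟩
      exact absSum_nonneg T l
    · have hcont : Continuous fun a => |T a| := hT.sup hT.neg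
      refine ((TopologicalSpace.isSeparable_range hcont).span (R := ℝ)).mono ?_
      rintro _ ⟨l, -, -, rfl⟩
      refine list_sum_mem fun y hy => ?_
      obtain ⟨a, -, rfl⟩ := List.mem_map.1 hy
      exact Submodule.subset_span ⟨a, rfl⟩
    · rintro _ ⟨l, hl, rfl, rfl⟩
      rw [hE.norm_list_sum l hl]
      clear hl hx
      induction l with
      | nil => simp
      | cons a l ih =>
        rw [absSum_cons, List.map_cons, List.sum_cons, mul_add]
        refine (norm_add_le _ _).trans (add_le_add ?_ ih)
        rw [norm_abs_eq_norm]
        exact T'.le_opNorm a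
  choose! M hM using hex
  have hTM : ∀ x, 0 ≤ x → |T x| ≤ M x := fun x hx =>
    (hM x hx).1 ⟨[x], by simpa using hx, by simp, by simp⟩
  obtain ⟨P, hP⟩ := exists_positiveLinearMap_extension M
    (fun x hx => (abs_nonneg _).trans (hTM x hx))
    (fun x y hx hy => (hM _ (add_nonneg hx hy)).unique
      (isLUB_modulusSums_add T hx hy (hM x hx) (hM y hy)))
    (fun c x hc hx => by
      rcases hc.eq_or_lt with rfl | hc
      · have := (hM _ (add_nonneg le_rfl le_rfl)).unique
          (isLUB_modulusSums_add T le_rfl le_rfl (hM 0 le_rfl) (hM 0 le_rfl))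
        simpa using this
      · exact (hM _ (smul_nonneg hc.le hx)).unique (isLUB_modulusSums_smul T hc (hM x hx)))
  refine ⟨P, PositiveLinearMap.mk₀ (P.toLinearMap - T) fun x hx => ?_, ?_⟩
  · change 0 ≤ P x - T x
    rw [hP x hx, sub_nonneg]
    exact (le_abs_self _).trans (hTM x hx)
  · ext x
    change T x = P x - (P x - T x)
    abel

end Levi

/-! ### `L₁` as an L-space -/

section L1

variable {α : Type*} [MeasurableSpace α] {μ : Measure α}

instance Lp.instIsOrderedModuleReal {p : ENNReal} : IsOrderedModule ℝ (Lp ℝ p μ) where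
  smul_le_smul_of_nonneg_left c hc f g hfg := by
    rw [← Lp.coeFn_le] at hfg ⊢
    filter_upwards [hfg, Lp.coeFn_smul c f, Lp.coeFn_smul c g] with t h1 h2 h3
    rw [h2, h3]
    exact mul_le_mul_of_nonneg_left h1 hc
  smul_le_smul_of_nonneg_right f hf c d hcd := by
    rw [← Lp.coeFn_nonneg] at hf
    rw [← Lp.coeFn_le]
    filter_upwards [hf, Lp.coeFn_smul c f, Lp.coeFn_smul d f] with t h1 h2 h3
    rw [h2, h3]
    exact mul_le_mul_of_nonneg_right hcd h1

theorem additiveNorm_L1 : AdditiveNorm (Lp ℝ 1 μ) := by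
  intro f g hf hg
  rw [← Lp.coeFn_nonneg] at hf hg
  simp only [L1.norm_eq_integral_norm]
  rw [← integral_add (L1.integrable_coeFn f).norm (L1.integrable_coeFn g).norm]
  refine integral_congr_ae ?_
  filter_upwards [hf, hg, Lp.coeFn_add f g] with t h1 h2 h3
  rw [h3, Pi.add_apply, Real.norm_of_nonneg h1, Real.norm_of_nonneg h2,
    Real.norm_of_nonneg (add_nonneg h1 h2)]

end L1

/-! ### Universe lifting, as (b) ranges over a universe that need not contain `L₁` -/

namespace ULift

variable {E : Type u}

instance [AddCommMonoid E] [PartialOrder E] [IsOrderedAddMonoid E] :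
    IsOrderedAddMonoid (ULift.{v} E) where
  add_le_add_left a b h c := by
    change a.down + c.down ≤ b.down + c.down
    exact add_le_add_left (α := E) h c.down

instance [AddCommGroup E] [Module ℝ E] [PartialOrder E] [IsOrderedModule ℝ E] :
    IsOrderedModule ℝ (ULift.{v} E) where
  smul_le_smul_of_nonneg_left c hc a b h := by
    change c • a.down ≤ c • b.down
    exact smul_le_smul_of_nonneg_left (show a.down ≤ b.down from h) hc
  smul_le_smul_of_nonneg_right a ha c d h := by
    change c • a.down ≤ d • a.down
    exact smul_le_smul_of_nonneg_right h (show 0 ≤ a.down from ha)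

instance [NormedAddCommGroup E] [Lattice E] [HasSolidNorm E] : HasSolidNorm (ULift.{v} E) where
  solid a b h := by
    change ‖a.down‖ ≤ ‖b.down‖
    exact norm_le_norm_of_abs_le_abs (show |a.down| ≤ |b.down| from h)

instance [TopologicalSpace E] [TopologicalSpace.SeparableSpace E] :
    TopologicalSpace.SeparableSpace (ULift.{v} E) :=
  Homeomorph.ulift.symm.surjective.denseRange.separableSpace Homeomorph.ulift.symm.continuous

end ULift

theorem AdditiveNorm.ulift {E : Type u} [NormedAddCommGroup E] [Preorder E] (h : AdditiveNorm E) :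
    AdditiveNorm (ULift.{v} E) :=
  fun x y hx hy => h x.down y.down hx hy

theorem continuousOperators_subset_of_ulift {E : Type u} {F : Type*} [NormedAddCommGroup E]
    [NormedSpace ℝ E] [PartialOrder E] [NormedAddCommGroup F] [NormedSpace ℝ F] [PartialOrder F]
    (h : continuousOperators (ULift.{v} E) F ⊆ regularOperators (ULift.{v} E) F) :
    continuousOperators E F ⊆ regularOperators E F := by
  intro T hT
  let up : E →ₚ[ℝ] ULift.{v} E :=
    { (ULift.moduleEquiv (R := ℝ) (M := E)).symm.toLinearMap with monotone' := fun _ _ h => h }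
  obtain ⟨P, Q, hPQ⟩ := h (show T.comp (ULift.moduleEquiv (R := ℝ) (M := E)).toLinearMap ∈
    continuousOperators (ULift.{v} E) F from hT.comp continuous_uliftDown)
  refine ⟨P.comp up, Q.comp up, ?_⟩
  ext x
  exact LinearMap.congr_fun hPQ (ULift.up x)

theorem theorem3p1 (F : Type u) [NormedAddCommGroup F] [NormedSpace ℝ F] [Lattice F]
    [IsOrderedAddMonoid F] [IsOrderedModule ℝ F] [HasSolidNorm F] [CompleteSpace F]
    (hF : DedekindSigmaComplete F) :
    List.TFAE [
      SequentiallyLevi F,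
      ∀ (E : Type v) [NormedAddCommGroup E] [NormedSpace ℝ E] [Lattice E]
        [IsOrderedAddMonoid E] [IsOrderedModule ℝ E] [HasSolidNorm E] [CompleteSpace E]
        [TopologicalSpace.SeparableSpace E],
        AdditiveNorm E → continuousOperators E F = regularOperators E F,
      continuousOperators L1Interval F = regularOperators L1Interval F] := by
  tfae_have 1 → 2 := by
    intro h E _ _ _ _ _ _ _ _ hE
    exact (h.continuousOperators_subset hE).antisymm regularOperators_subset_continuousOperators
  tfae_have 2 → 3 := by
    intro h
    refine Set.Subset.antisymm ?_ regularOperators_subset_continuousOperators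
    refine continuousOperators_subset_of_ulift.{0, v} ?_
    -- Separability of `Lp` is inferred from a finite exponent.
    have : Fact ((1 : ENNReal) ≠ ⊤) := ⟨ENNReal.one_ne_top⟩
    exact (h (ULift.{v} L1Interval) additiveNorm_L1.ulift).subset
  tfae_have 3 → 1 := fun h =>
    (BoundedSummands.of_continuousOperators_subset h.subset).sequentiallyLevi hF
  tfae_finish
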